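/- **Conventions.** A locale is a frame $L$, with bottom $0$ and top $1$. A sublocale of $L$ is a subset closed under arbitrary meets and under $x\to(\cdot)$ for all $x\in L$. Sublocales are ordered by inclusion, $\emptyset$ denotes the void sublocale $\{1\}$, and two sublocales are disjoint if their intersection is $\emptyset$. For $a\in L$, $\mathfrak c(a)=\{x: a\le x\}$ and $\mathfrak o(a)=\{x: a\to x=x\}$ are the closed and the open sublocale of $a$; they are complements of each other. $L\setminus S$ is the complement of a complemented sublocale $S$, $\overline S=\mathfrak c(\bigwedge S)$ is the closure of $S$, and its boundary $\partial S$ is $\overline S$ minus the join of all open sublocales contained in $S$. An element $x\in L$ is connected if $x=b\vee c$ and $b\wedge c=0$ imply $b=0$ or $c=0$. $L$ is connected if $1$ is connected, and locally connected if every element is a join of connected elements. A sublocale is connected if it is connected as a locale. $L$ is strongly locally connected if for every open sublocale $U$ and every $x\in U$ there is a connected open sublocale $V\subseteq U$ with $x\in V$. $L$ is normal if $a\vee b=1$ implies that there are $u,v\in L$ with $u\wedge v=0$ and $a\vee u=1=b\vee v$. A continuum is a non-void connected closed sublocale. A component of a sublocale $T$ is a non-void connected sublocale $D\subseteq T$ that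 contains every connected sublocale of $T$ that is not disjoint from $D$. A complemented sublocale $S$ separates $x\in L$ from $y\in L$ if $L\setminus S$ is not connected and there are $a,b\in L$ with $L\setminus S\subseteq \mathfrak c(a)\vee\mathfrak c(b)$, $(L\setminus S)\cap\mathfrak c(a)\cap\mathfrak c(b)=\emptyset$, $(L\setminus S)\cap\mathfrak c(a)\neq\emptyset\neq(L\setminus S)\cap\mathfrak c(b)$, $x\in(L\setminus S)\cap\mathfrak c(a)$ and $y\in (L\setminus S)\cap\mathfrak c(b)$. Consider the following properties of $L$. * $(N^+)$ If $\mathfrak c(u),\mathfrak c(v)$ are disjoint and $x\in\mathfrak c(u)$, $y\in\mathfrak c(v)$ with $x\ne1\ne y$, then some continuum contained in $L\setminus(\mathfrak c(u)\vee\mathfrak c(v))$ separates $x$ from $y$. * $(N)$ If $\mathfrak c(u),\mathfrak c(v)$ are disjoint and $X\subseteq\mathfrak c(u)$, $Y\subseteq\mathfrak c(v)$ are non-void sublocales, then some continuum contained in $L\setminus(\mathfrak c(u)\vee\mathfrak c(v))$ separates an element $x\neq 1$ of $X$ from an element $y\ne 1$ of $Y$. * Unicoherence: if $L=H\vee K$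 with continua $H,K$, then $H\cap K$ is a continuum. * Brouwer property: if $C$ is a continuum, then $\partial D$ is a continuum for every component $D$ of $L\setminus C$. * $(I^+)$ If $x\ne1\ne y$, $\mathfrak c(u),\mathfrak c(v)$ are disjoint, and neither $\mathfrak c(u)$ nor $\mathfrak c(v)$ separates $x$ from $y$, then $\mathfrak c(u)\vee\mathfrak c(v)$ does not separate $x$ from $y$. **Theorem.** Let $L$ be a connected and locally connected locale. 1. $(N^+)\Rightarrow(N)\Rightarrow$ unicoherence. 2. If $L$ is normal, then the Brouwer property implies $(N)$, and $(N)$ is equivalent to unicoherence. 3. If $L$ is normal and strongly locally connected, then the Brouwer property implies $(N^+)$, and $(N^+)$, $(N)$, unicoherence and $(I^+)$ are all equivalent. -/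

import Mathlib

/-!
# Pointfree topology: connectedness, unicoherence and separation conditions for locales

A locale is a frame `L` (`Order.Frame L`), and its sublocales are Mathlib's `Sublocale L`, ordered by
inclusion: subsets of `L` closed under arbitrary meets and under `x ⇨ ·`.  Meets `⊓` of sublocales
are intersections, `⊔` is the join of sublocales, the void sublocale `{1}` is `⊥`, the whole locale
is `⊤`, and `￢S` is the supplement of `S`, that is, the least `T` with `S ⊔ T = ⊤`
(the complement `L ∖ S` as soon as `S` is complemented).
-/

namespace PointFree

variable {L : Type*} [Order.Frame L]

/-- The open sublocale `𝔬(a) = {x | a ⇨ x = x}`. -/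
def openSub (a : L) : Sublocale L where
  carrier := {x | a ⇨ x = x}
  sInf_mem' s hs := by
    have h : ∀ x ∈ s, a ⇨ x = x := fun x hx => hs hx
    refine le_antisymm (le_sInf fun x hx => ?_) le_himp
    calc a ⇨ sInf s ≤ a ⇨ x := himp_le_himp_left (sInf_le hx)
      _ = x := h x hx
  himp_mem' b x hx := by
    have h : a ⇨ x = x := hx
    change a ⇨ (b ⇨ x) = b ⇨ x
    rw [himp_left_comm, h]

/-- The closed sublocale `𝔠(a) = ↑a = {x | a ≤ x}`. -/
def closedSub (a : L) : Sublocale L where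
  carrier := {x | a ≤ x}
  sInf_mem' _ hs := le_sInf fun _ hx => hs hx
  himp_mem' _ _ hx := le_trans hx le_himp

/-- An element `x` is connected if `x = b ∨ c` with `b ∧ c = 0` forces `b = 0` or `c = 0`. -/
def IsConnectedElement (x : L) : Prop :=
  ∀ b c : L, x = b ⊔ c → b ⊓ c = ⊥ → b = ⊥ ∨ c = ⊥

/-- A locale is connected if its top element is connected. -/
def IsConnectedLocale (L : Type*) [Order.Frame L] : Prop :=
  IsConnectedElement (⊤ : L)

/-- A locale is locally connected if every element is a join of connected elements. -/
def IsLocallyConnected (L : Type*) [Order.Frame L] : Prop :=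
  ∀ a : L, ∃ s : Set L, (∀ x ∈ s, IsConnectedElement x) ∧ sSup s = a

/-- A sublocale is connected if it is connected as a locale in its own right. -/
def IsConnectedSub (S : Sublocale L) : Prop :=
  IsConnectedLocale S

/-- A locale is strongly locally connected if every element `x` of every open sublocale `𝔬(u)` lies
in a connected open sublocale contained in `𝔬(u)`. -/
def IsStronglyLocallyConnected (L : Type*) [Order.Frame L] : Prop :=
  ∀ u : L, ∀ x ∈ openSub u, ∃ v : L,
    openSub v ≤ openSub u ∧ IsConnectedSub (openSub v) ∧ x ∈ openSub v

/-- A locale is normal if `a ∨ b = 1` implies that there are `u`, `v` with `u ∧ v = 0`,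
`a ∨ u = 1` and `b ∨ v = 1`. -/
def IsNormalLocale (L : Type*) [Order.Frame L] : Prop :=
  ∀ a b : L, a ⊔ b = ⊤ → ∃ u v : L, u ⊓ v = ⊥ ∧ a ⊔ u = ⊤ ∧ b ⊔ v = ⊤

/-- The closure `↑(⋀ S)` of a sublocale. -/
def closureSub (S : Sublocale L) : Sublocale L :=
  closedSub (sInf (S : Set L))

/-- The interior of a sublocale: the join of all open sublocales contained in it. -/
def interiorSub (S : Sublocale L) : Sublocale L :=
  sSup {U : Sublocale L | (∃ u : L, U = openSub u) ∧ U ≤ S}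

/-- The boundary of a sublocale: closure minus interior. -/
def boundarySub (S : Sublocale L) : Sublocale L :=
  closureSub S \ interiorSub S

/-- A continuum is a non-void connected closed sublocale. -/
def IsContinuum (S : Sublocale L) : Prop :=
  (∃ u : L, S = closedSub u) ∧ S ≠ ⊥ ∧ IsConnectedSub S

/-- `D` is a component of `T`: a non-void connected sublocale of `T` which contains every connected
sublocale of `T` that meets it. -/
def IsComponent (D T : Sublocale L) : Prop :=
  D ≤ T ∧ D ≠ ⊥ ∧ IsConnectedSub D ∧
    ∀ S : Sublocale L, S ≤ T → IsConnectedSub S → S ⊓ D ≠ ⊥ → S ≤ D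

/-- The closed sublocales `𝔠(a)` and `𝔠(b)` form a separation of `T`. -/
def IsSeparation (T : Sublocale L) (a b : L) : Prop :=
  T ≤ closedSub a ⊔ closedSub b ∧ T ⊓ closedSub a ⊓ closedSub b = ⊥ ∧
    T ⊓ closedSub a ≠ ⊥ ∧ T ⊓ closedSub b ≠ ⊥

/-- The (complemented) sublocale `S` separates the element `x` from the element `y` in `L`: its
complement is not connected and has a separation by `𝔠(a)` and `𝔠(b)`, with `x` in the part
`(L ∖ S) ∩ 𝔠(a)` and `y` in the part `(L ∖ S) ∩ 𝔠(b)`. -/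
def Separates (S : Sublocale L) (x y : L) : Prop :=
  ¬ IsConnectedSub (￢S) ∧ ∃ a b : L, IsSeparation (￢S) a b ∧
    x ∈ ￢S ⊓ closedSub a ∧ y ∈ ￢S ⊓ closedSub b

/-- A locale is unicoherent if, whenever it is the join of two continua, their intersection is a
continuum. -/
def IsUnicoherent (L : Type*) [Order.Frame L] : Prop :=
  ∀ H K : Sublocale L, IsContinuum H → IsContinuum K → (⊤ : Sublocale L) = H ⊔ K →
    IsContinuum (H ⊓ K)

/-- The Brouwer property: every component of the complement of a continuum has a continuum as its
boundary. -/
def BrouwerProperty (L : Type*) [Order.Frame L] : Prop :=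
  ∀ C : Sublocale L, IsContinuum C → ∀ D : Sublocale L, IsComponent D (￢C) →
    IsContinuum (boundarySub D)

/-- Condition (I⁺): if neither of two disjoint closed sublocales separates `x` from `y`, then neither
does their join. -/
def PropertyIPlus (L : Type*) [Order.Frame L] : Prop :=
  ∀ x y : L, x ≠ ⊤ → y ≠ ⊤ → ∀ u v : L, closedSub u ⊓ closedSub v = ⊥ →
    ¬ Separates (closedSub u) x y → ¬ Separates (closedSub v) x y →
    ¬ Separates (closedSub u ⊔ closedSub v) x y

/-- Condition (N⁺): elements `x`, `y` (other than `1`) of disjoint closed sublocales are separated by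
a continuum contained in the complement of the join of these sublocales. -/
def PropertyNPlus (L : Type*) [Order.Frame L] : Prop :=
  ∀ u v : L, closedSub u ⊓ closedSub v = ⊥ →
    ∀ x ∈ closedSub u, ∀ y ∈ closedSub v, x ≠ ⊤ → y ≠ ⊤ →
      ∃ W : Sublocale L, IsContinuum W ∧ W ≤ ￢(closedSub u ⊔ closedSub v) ∧ Separates W x y

/-- Condition (N): for non-void sublocales `X`, `Y` of disjoint closed sublocales, some continuum
contained in the complement of the join of the closed sublocales separates an element of `X`
(other than `1`) from an element of `Y` (other than `1`). -/
def PropertyN (L : Type*) [Order.Frame L] : Prop :=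
  ∀ u v : L, closedSub u ⊓ closedSub v = ⊥ →
    ∀ X Y : Sublocale L, X ≤ closedSub u → Y ≤ closedSub v → X ≠ ⊥ → Y ≠ ⊥ →
      ∃ W : Sublocale L, IsContinuum W ∧ W ≤ ￢(closedSub u ⊔ closedSub v) ∧
        ∃ x ∈ X, x ≠ ⊤ ∧ ∃ y ∈ Y, y ≠ ⊤ ∧ Separates W x y

end PointFree

/-!
# Separation conditions and unicoherence for locally connected locales

Closed sublocales are handled through their elements: `𝔠(a)` is connected when `b ∨ c ∨ a = 1` and
`b ∧ c ≤ a` force `b ≤ a` or `c ≤ a`, and `𝔬(a)` is connected when `a` is a connected element.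
`𝔠(w)` separates `x` from `y` exactly when `w = b ∨ c` with `b ∧ c = 0`, `b ≤ x`, `c ≤ y`, where
`x` and `y` lie in `𝔬(w)` (`separates_closedSub_iff`).  In a locally connected locale every nonzero
connected element below `a` lies below a component `k` of `a`, which splits off as `a = k ∨ e`,
`k ∧ e = 0` (`exists_component`).

The pivot is the condition `FrontierConnected`: if the complement `𝔠(k ∨ e)` of a disjoint open
union `𝔬(k) ∨ 𝔬(e)` is a continuum and `𝔬(k)` is connected, then the boundary `𝔠(k ∨ k*)` of `𝔬(k)`
is connected.  It is the Brouwer property for open components, so the Brouwer property implies it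
(`BrouwerProperty.frontierConnected`).  Unicoherence implies it as well: `L` is the
join of the closure `𝔠(k*)` of `𝔬(k)` and of `𝔠(k)`, both are continua, and they meet in the boundary
(`IsUnicoherent.frontierConnected`).

Given disjoint `𝔠(u)` and `𝔠(v)`, normality provides disjoint open neighbourhoods `𝔬(s)` and `𝔬(t)`
of them.  Take a component `c` of `s` meeting the first set and a component `d` of `c*` meeting the
second one.  The boundary `𝔠(d ∨ d*)` of `𝔬(d)` avoids `𝔠(u)` and `𝔠(v)` and separates `𝔬(c)` from
`𝔬(d)` (`frontier_separates`), and it is a continuum under `FrontierConnected`.  This yields `(N)`;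
strong local connectedness lets `𝔬(c)` and `𝔬(d)` contain prescribed elements, which yields `(N⁺)`.

For `(I⁺) ⇒ (N⁺)` the same boundary is used.  If it were a disjoint union of non-void `𝔠(f)` and
`𝔠(g)`, then by `(I⁺)` one of them, say `𝔠(f)`, would separate `x` from `y`; but `𝔠(g)` lies in the
closure both of `𝔬(d)` and of the component of `d*` containing `𝔬(c)`, so it is disjoint from both
parts of the separation.  For the converse, if `𝔠(u ∧ v)` separates `x` from
`y`, let `p` be the component of `u ∧ v` containing `x` and `r` the component of `p*` containing `y`:
the boundary of `𝔬(r)` is a continuum inside `𝔠(u) ∨ 𝔠(v)`, hence inside one of them, which then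
separates `x` from `y`.  Finally, `(N)` gives unicoherence because a continuum that
avoids `H ∩ K` misses `H` or `K`, and a connected set cannot be separated by a set it misses.
-/

namespace PointFree

variable {L : Type*} [Order.Frame L]

/-! ### Open and closed sublocales -/

theorem mem_openSub {a x : L} : x ∈ openSub a ↔ a ⇨ x = x := Iff.rfl

theorem mem_closedSub {a x : L} : x ∈ closedSub a ↔ a ≤ x := Iff.rfl

theorem mem_inf_sub {S T : Sublocale L} {x : L} : x ∈ S ⊓ T ↔ x ∈ S ∧ x ∈ T := by
  refine ⟨fun h => ⟨(inf_le_left : S ⊓ T ≤ S) h, (inf_le_right : S ⊓ T ≤ T) h⟩, fun h => ?_⟩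
  let I : Sublocale L :=
    { carrier := {x | x ∈ S ∧ x ∈ T}
      sInf_mem' := fun s hs =>
        ⟨Sublocale.sInf_mem fun x hx => (hs hx).1, Sublocale.sInf_mem fun x hx => (hs hx).2⟩
      himp_mem' := fun _ _ hx => ⟨Sublocale.himp_mem hx.1, Sublocale.himp_mem hx.2⟩ }
  have hI : I ≤ S ⊓ T := le_inf (fun x hx => hx.1) (fun x hx => hx.2)
  exact hI h

theorem mem_bot_sub {x : L} : x ∈ (⊥ : Sublocale L) ↔ x = ⊤ := by
  constructor
  · intro h
    have h1 : x ∈ openSub (⊥ : L) := (bot_le : ⊥ ≤ openSub (⊥ : L)) h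
    rw [mem_openSub, bot_himp] at h1
    exact h1.symm
  · rintro rfl
    exact Sublocale.top_mem

theorem sub_eq_bot_iff {S : Sublocale L} : S = ⊥ ↔ ∀ x ∈ S, x = ⊤ := by
  constructor
  · rintro rfl x hx
    exact mem_bot_sub.1 hx
  · exact fun h => le_bot_iff.1 fun x hx => mem_bot_sub.2 (h x hx)

theorem sub_ne_bot_iff {S : Sublocale L} : S ≠ ⊥ ↔ ∃ x ∈ S, x ≠ ⊤ := by
  rw [Ne, sub_eq_bot_iff]
  push Not
  rfl

theorem closedSub_bot : closedSub (⊥ : L) = ⊤ :=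
  top_le_iff.1 fun _ _ => bot_le

theorem sub_le_openSub_iff {S : Sublocale L} {a : L} :
    S ≤ openSub a ↔ ∀ x ∈ S, a ≤ x → x = ⊤ := by
  constructor
  · intro h x hx hax
    have h1 : a ⇨ x = x := h hx
    rw [← h1, himp_eq_top_iff]
    exact hax
  · intro h x hx
    rw [mem_openSub]
    refine le_antisymm ?_ le_himp
    -- `(a ⇨ x) ⇨ x` belongs to `S` and lies above `a`.
    have h1 := h ((a ⇨ x) ⇨ x) (Sublocale.himp_mem hx) le_himp_himp
    exact himp_eq_top_iff.1 h1

theorem closedSub_le_closedSub_iff {a b : L} : closedSub a ≤ closedSub b ↔ b ≤ a :=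
  ⟨fun h => h (le_refl a), fun h _ hx => h.trans hx⟩

theorem openSub_le_openSub_iff {a b : L} : openSub a ≤ openSub b ↔ a ≤ b := by
  rw [sub_le_openSub_iff]
  constructor
  · intro h
    have h1 := h (a ⇨ b) himp_idem le_himp
    exact himp_eq_top_iff.1 h1
  · intro h x hx hbx
    rw [← mem_openSub.1 hx, himp_eq_top_iff]
    exact h.trans hbx

theorem closedSub_le_openSub_iff {a b : L} : closedSub a ≤ openSub b ↔ a ⊔ b = ⊤ := by
  rw [sub_le_openSub_iff]
  exact ⟨fun h => h _ le_sup_left le_sup_right,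
    fun h x hx hb => top_le_iff.1 (h ▸ sup_le hx hb)⟩

theorem openSub_le_closedSub_iff {a b : L} : openSub a ≤ closedSub b ↔ a ⊓ b = ⊥ := by
  constructor
  · intro h
    have h1 : b ≤ a ⇨ ⊥ := h (himp_idem : a ⇨ a ⇨ ⊥ = a ⇨ ⊥)
    rw [le_himp_iff] at h1
    rw [inf_comm]
    exact le_bot_iff.1 h1
  · intro h x hx
    rw [mem_closedSub, ← mem_openSub.1 hx, le_himp_iff, inf_comm, h]
    exact bot_le

theorem closedSub_inf (a b : L) : closedSub a ⊓ closedSub b = closedSub (a ⊔ b) := by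
  ext x
  simp only [mem_inf_sub, mem_closedSub, sup_le_iff]

theorem closedSub_sup (a b : L) : closedSub a ⊔ closedSub b = closedSub (a ⊓ b) := by
  refine le_antisymm (sup_le (closedSub_le_closedSub_iff.2 inf_le_left)
    (closedSub_le_closedSub_iff.2 inf_le_right)) fun x hx => ?_
  have h1 : x = (x ⊔ a) ⊓ (x ⊔ b) := by
    rw [← sup_inf_left, sup_eq_left.2 hx]
  rw [h1]
  exact Sublocale.inf_mem
    ((le_sup_left : closedSub a ≤ closedSub a ⊔ closedSub b) (mem_closedSub.2 le_sup_right))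
    ((le_sup_right : closedSub b ≤ closedSub a ⊔ closedSub b) (mem_closedSub.2 le_sup_right))

theorem closedSub_eq_bot_iff {a : L} : closedSub a = ⊥ ↔ a = ⊤ := by
  rw [sub_eq_bot_iff]
  exact ⟨fun h => h a le_rfl, fun h x hx => top_le_iff.1 (h ▸ hx)⟩

theorem openSub_ne_bot {a : L} (ha : a ≠ ⊥) : openSub a ≠ ⊥ := fun h =>
  ha (le_bot_iff.1 (openSub_le_openSub_iff.1 (h ▸ bot_le)))

theorem isCompl_closedSub_openSub (a : L) : IsCompl (closedSub a) (openSub a) := by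
  rw [isCompl_iff, disjoint_iff, codisjoint_iff]
  constructor
  · rw [sub_eq_bot_iff]
    intro x hx
    obtain ⟨h1, h2⟩ := mem_inf_sub.1 hx
    rw [← mem_openSub.1 h2, himp_eq_top_iff]
    exact h1
  · refine top_le_iff.1 fun x _ => ?_
    have h1 : x = (x ⊔ a) ⊓ (a ⇨ x) := by
      rw [inf_sup_right, inf_himp, inf_eq_left.2 (le_himp : x ≤ a ⇨ x), sup_eq_left.2 inf_le_right]
    rw [h1]
    exact Sublocale.inf_mem
      ((le_sup_left : closedSub a ≤ closedSub a ⊔ openSub a) (mem_closedSub.2 le_sup_right))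
      ((le_sup_right : openSub a ≤ closedSub a ⊔ openSub a) (mem_openSub.2 himp_idem))

theorem hnot_closedSub (a : L) : ￢closedSub a = openSub a :=
  (isCompl_closedSub_openSub a).hnot_eq

theorem le_hnot_closedSub_sup_iff {u v w : L} :
    closedSub w ≤ ￢(closedSub u ⊔ closedSub v) ↔ w ⊔ u ⊓ v = ⊤ := by
  rw [closedSub_sup, hnot_closedSub, closedSub_le_openSub_iff]

theorem closureSub_openSub (a : L) : closureSub (openSub a) = closedSub aᶜ := by
  refine congrArg closedSub (le_antisymm (sInf_le ?_) (le_sInf fun x hx => ?_))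
  · change a ⇨ aᶜ = aᶜ
    rw [← himp_bot, himp_idem]
  · have h : a ⇨ x = x := hx
    rw [← h, ← himp_bot]
    exact himp_le_himp_left bot_le

theorem boundarySub_openSub (a : L) : boundarySub (openSub a) = closedSub (a ⊔ aᶜ) := by
  have hint : interiorSub (openSub a) = openSub a :=
    le_antisymm (sSup_le fun _ hU => hU.2) (le_sSup ⟨⟨a, rfl⟩, le_rfl⟩)
  rw [boundarySub, hint, closureSub_openSub]
  have hc := isCompl_closedSub_openSub a
  refine le_antisymm ?_ ?_
  · rw [sdiff_le_iff, sup_comm a, ← closedSub_inf, sup_inf_left, sup_comm _ (closedSub a),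
      hc.sup_eq_top, inf_top_eq]
    exact le_sup_right
  · have h1 : closedSub (a ⊔ aᶜ) ≤ openSub a ⊔ closedSub aᶜ \ openSub a :=
      (closedSub_le_closedSub_iff.2 le_sup_right).trans le_sup_sdiff
    calc closedSub (a ⊔ aᶜ)
        ≤ (openSub a ⊔ closedSub aᶜ \ openSub a) ⊓ closedSub a :=
          le_inf h1 (closedSub_le_closedSub_iff.2 le_sup_left)
      _ ≤ closedSub aᶜ \ openSub a := by
          rw [inf_sup_right, inf_comm (openSub a), hc.inf_eq_bot, bot_sup_eq]
          exact inf_le_left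

/-! ### Connectedness -/

/-- A sublocale `S` is connected iff no two elements of the ambient frame disconnect it. -/
theorem isConnectedSub_iff {S : Sublocale L} :
    IsConnectedSub S ↔ ∀ a b : L, S ≤ openSub (a ⊔ b) → S ≤ closedSub (a ⊓ b) →
      S ≤ closedSub a ∨ S ≤ closedSub b := by
  have hgc := S.giRestrict.gc
  have hle : ∀ a : L, S ≤ closedSub a ↔ S.restrict a = ⊥ := by
    intro a
    rw [← le_bot_iff, hgc.le_iff_le]
    refine ⟨fun h => h (Subtype.prop _), fun h x hx => h.trans ?_⟩
    exact (bot_le : (⊥ : S) ≤ ⟨x, hx⟩)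
  constructor
  · intro h a b h1 h2
    rw [hle] at h2 ⊢
    rw [hle]
    refine h _ _ ?_ (by rw [← map_inf, h2])
    rw [← map_sup]
    symm
    refine Subtype.ext ?_
    exact sub_le_openSub_iff.1 h1 _ (Subtype.prop _) (hgc.le_u_l _)
  · intro h b c h1 h2
    have h3 := h b.1 c.1 ?_ ?_
    · simpa only [hle, S.giRestrict.l_u_eq] using h3
    · rw [sub_le_openSub_iff]
      intro x hx hbc
      have h4 : b ⊔ c ≤ (⟨x, hx⟩ : S) :=
        sup_le (le_sup_left.trans hbc : b.1 ≤ x) (le_sup_right.trans hbc : c.1 ≤ x)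
      rw [← h1, top_le_iff] at h4
      exact congrArg Subtype.val h4
    · rw [hle, ← Sublocale.coe_inf, h2, S.giRestrict.l_u_eq]

theorem isConnectedSub_closedSub_iff {a : L} :
    IsConnectedSub (closedSub a) ↔ ∀ b c : L, b ⊔ c ⊔ a = ⊤ → b ⊓ c ≤ a → b ≤ a ∨ c ≤ a := by
  simp only [isConnectedSub_iff, closedSub_le_openSub_iff, closedSub_le_closedSub_iff,
    sup_comm a]

theorem isContinuum_closedSub_iff {a : L} :
    IsContinuum (closedSub a) ↔ a ≠ ⊤ ∧ IsConnectedSub (closedSub a) := by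
  rw [IsContinuum, Ne, closedSub_eq_bot_iff]
  exact ⟨fun h => h.2, fun h => ⟨⟨a, rfl⟩, h⟩⟩

theorem IsConnectedElement.disjoint_or {x b c : L} (hx : IsConnectedElement x)
    (h : x ≤ b ⊔ c) (hd : x ⊓ (b ⊓ c) = ⊥) : x ⊓ b = ⊥ ∨ x ⊓ c = ⊥ := by
  refine hx _ _ ?_ ?_
  · rw [← inf_sup_left, inf_eq_left.2 h]
  · rw [← inf_inf_distrib_left, hd]

theorem IsConnectedElement.le_or {x b c : L} (hx : IsConnectedElement x)
    (h : x ≤ b ⊔ c) (hd : b ⊓ c = ⊥) : x ≤ b ∨ x ≤ c := by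
  have hxe : x = x ⊓ b ⊔ x ⊓ c := by rw [← inf_sup_left, inf_eq_left.2 h]
  rcases hx.disjoint_or h (by rw [hd, inf_bot_eq]) with h1 | h1
  · rw [h1, bot_sup_eq] at hxe
    exact Or.inr (inf_eq_left.1 hxe.symm)
  · rw [h1, sup_bot_eq] at hxe
    exact Or.inl (inf_eq_left.1 hxe.symm)

theorem isConnectedSub_openSub_iff {a : L} :
    IsConnectedSub (openSub a) ↔ IsConnectedElement a := by
  simp only [isConnectedSub_iff, openSub_le_openSub_iff, openSub_le_closedSub_iff]
  constructor
  · intro h b c h1 h2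
    have hb : b ≤ a := h1 ▸ le_sup_left
    have hc : c ≤ a := h1 ▸ le_sup_right
    have h3 := h b c h1.le (by rw [h2, inf_bot_eq])
    rwa [inf_eq_right.2 hb, inf_eq_right.2 hc] at h3
  · exact fun h b c h1 h2 => h.disjoint_or h1 h2

theorem IsConnectedElement.sup {y k : L} (hy : IsConnectedElement y) (hk : IsConnectedElement k)
    (h : y ⊓ k ≠ ⊥) : IsConnectedElement (y ⊔ k) := by
  intro b c h1 h2
  have hb : b ≤ y ⊔ k := h1 ▸ le_sup_left
  have hc : c ≤ y ⊔ k := h1 ▸ le_sup_right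
  rcases hy.le_or (h1 ▸ le_sup_left) h2 with hyb | hyc <;>
    rcases hk.le_or (h1 ▸ le_sup_right) h2 with hkb | hkc
  · right
    rw [← h2]
    exact (inf_eq_right.2 (hc.trans (sup_le hyb hkb))).symm
  · exact absurd (le_bot_iff.1 (h2 ▸ inf_le_inf hyb hkc)) h
  · refine absurd (le_bot_iff.1 ?_) h
    rw [← h2, inf_comm b]
    exact inf_le_inf hyc hkb
  · left
    rw [← h2]
    exact (inf_eq_left.2 (hb.trans (sup_le hyc hkc))).symm

/-- The closure of a connected open sublocale is connected. -/
theorem IsConnectedElement.isConnectedSub_closedSub_compl {k : L} (hk : IsConnectedElement k) :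
    IsConnectedSub (closedSub kᶜ) := by
  rw [isConnectedSub_closedSub_iff]
  intro b c h1 h2
  have h3 : k ≤ b ⊔ c := by
    have : k = k ⊓ (b ⊔ c ⊔ kᶜ) := by rw [h1, inf_top_eq]
    rw [inf_sup_left, inf_compl_self, sup_bot_eq] at this
    exact inf_eq_left.1 this.symm
  have h4 : k ⊓ (b ⊓ c) = ⊥ := (disjoint_iff.1 (le_compl_iff_disjoint_left.1 h2))
  simpa only [le_compl_iff_disjoint_left, disjoint_iff] using hk.disjoint_or h3 h4

/-! ### Components of open sublocales -/

/-- In a locally connected locale, a nonzero connected element `x ≤ a` lies below a connected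
component `k` of `a`, and `k` has a complement `e` in `a`. -/
theorem exists_component (hloc : IsLocallyConnected L) {x a : L} (hx : IsConnectedElement x)
    (hx0 : x ≠ ⊥) (hxa : x ≤ a) :
    ∃ k e : L, IsConnectedElement k ∧ x ≤ k ∧ k ⊔ e = a ∧ k ⊓ e = ⊥ := by
  set A : Set L := {y | IsConnectedElement y ∧ y ≤ a ∧ y ⊓ x ≠ ⊥} with hA
  have hxk : x ≤ sSup A := le_sSup ⟨hx, hxa, by rwa [inf_idem]⟩
  have hka : sSup A ≤ a := sSup_le fun y hy => hy.2.1
  -- Whichever half of a splitting of `sSup A` contains `x` contains every member of `A`.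
  have key : ∀ b c : L, sSup A = b ⊔ c → b ⊓ c = ⊥ → x ≤ b → c = ⊥ := by
    intro b c h1 h2 hxb
    have h3 : sSup A ≤ b := by
      refine sSup_le fun y hy => ?_
      refine (hy.1.le_or (h1 ▸ le_sSup hy) h2).resolve_right fun hyc => hy.2.2 ?_
      rw [inf_comm]
      exact le_bot_iff.1 (h2 ▸ inf_le_inf hxb hyc)
    rw [← h2]
    exact (inf_eq_right.2 ((h1 ▸ le_sup_right : c ≤ sSup A).trans h3)).symm
  have hk : IsConnectedElement (sSup A) := by
    intro b c h1 h2
    rcases hx.le_or (h1 ▸ hxk) h2 with h | h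
    · exact Or.inr (key b c h1 h2 h)
    · exact Or.inl (key c b (by rw [h1, sup_comm]) (by rw [inf_comm, h2]) h)
  have hdich : ∀ y, IsConnectedElement y → y ≤ a → sSup A ⊓ y ≠ ⊥ → y ≤ sSup A := by
    intro y hy hya hne
    rw [inf_comm] at hne
    refine le_sup_left.trans (le_sSup (s := A) ⟨hy.sup hk hne, sup_le hya hka, fun h => hx0 ?_⟩)
    rw [← h]
    exact (inf_eq_right.2 (hxk.trans le_sup_right)).symm
  obtain ⟨s, hs, hsa⟩ := hloc a
  refine ⟨sSup A, sSup {y ∈ s | sSup A ⊓ y = ⊥}, hk, hxk, le_antisymm ?_ ?_, ?_⟩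
  · exact sup_le hka (sSup_le fun y hy => hsa ▸ le_sSup hy.1)
  · conv_lhs => rw [← hsa]
    refine sSup_le fun y hy => ?_
    by_cases h : sSup A ⊓ y = ⊥
    · exact (le_sSup (s := {y ∈ s | sSup A ⊓ y = ⊥}) ⟨hy, h⟩).trans le_sup_right
    · exact (hdich y (hs y hy) (hsa ▸ le_sSup hy) h).trans le_sup_left
  · rw [inf_sSup_eq, iSup₂_eq_bot]
    exact fun y hy => hy.2

theorem openSub_mono_mem {a b x : L} (hab : a ≤ b) (hx : a ⇨ x = x) : b ⇨ x = x :=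
  openSub_le_openSub_iff.2 hab hx

theorem ne_bot_of_himp_eq {a x : L} (hx : a ⇨ x = x) (hx1 : x ≠ ⊤) : a ≠ ⊥ := by
  rintro rfl
  exact hx1 (by rw [← hx, bot_himp])

theorem not_le_of_himp_eq {a x : L} (hx : a ⇨ x = x) (hx1 : x ≠ ⊤) : ¬ a ≤ x := fun h =>
  hx1 (by rw [← hx, himp_eq_top_iff]; exact h)

/-- An open sublocale disjoint from one containing `x` lies below `x`. -/
theorem le_of_inf_eq_bot {a b x : L} (hx : a ⇨ x = x) (h : b ⊓ a = ⊥) : b ≤ x := by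
  rw [← hx, le_himp_iff, h]
  exact bot_le

theorem exists_component_meeting (hloc : IsLocallyConnected L) {X : Sublocale L} {s : L}
    (hX : X ≠ ⊥) (hXs : X ≤ openSub s) :
    ∃ k e : L, IsConnectedElement k ∧ k ⊔ e = s ∧ k ⊓ e = ⊥ ∧ ∃ x ∈ X, x ≠ ⊤ ∧ k ⇨ x = x := by
  obtain ⟨z, hz, hz1⟩ := sub_ne_bot_iff.1 hX
  obtain ⟨t, ht, hts⟩ := hloc s
  have hnle : ¬ sSup t ≤ z := hts ▸ not_le_of_himp_eq (hXs hz) hz1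
  rw [sSup_le_iff] at hnle
  push Not at hnle
  obtain ⟨y, hyt, hyz⟩ := hnle
  obtain ⟨k, e, hk, hyk, hke, hd⟩ := exists_component hloc (ht y hyt)
    (fun h => hyz (h ▸ bot_le)) (hts ▸ le_sSup hyt)
  refine ⟨k, e, hk, hke, hd, k ⇨ z, Sublocale.himp_mem hz, ?_, himp_idem⟩
  rw [Ne, himp_eq_top_iff]
  exact fun h => hyz (hyk.trans h)

theorem IsStronglyLocallyConnected.exists_component_mem (hslc : IsStronglyLocallyConnected L)
    (hloc : IsLocallyConnected L) {s x : L} (hx : s ⇨ x = x) (hx1 : x ≠ ⊤) :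
    ∃ k e : L, IsConnectedElement k ∧ k ⊔ e = s ∧ k ⊓ e = ⊥ ∧ k ⇨ x = x := by
  obtain ⟨v, hvs, hv, hxv⟩ := hslc s x hx
  rw [openSub_le_openSub_iff] at hvs
  rw [isConnectedSub_openSub_iff] at hv
  rw [mem_openSub] at hxv
  obtain ⟨k, e, hk, hvk, hke, hd⟩ := exists_component hloc hv (ne_bot_of_himp_eq hxv hx1) hvs
  exact ⟨k, e, hk, hke, hd, openSub_mono_mem hvk hxv⟩

/-! ### Separation by closed sublocales -/

/-- Separation by `𝔠(w)` of elements different from `1`, as a splitting of `w`.  The two parts are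
automatically nonzero. -/
theorem separates_closedSub_iff {w x y : L} (hx : x ≠ ⊤) (hy : y ≠ ⊤) :
    Separates (closedSub w) x y ↔ w ⇨ x = x ∧ w ⇨ y = y ∧
      ∃ b c : L, b ⊔ c = w ∧ b ⊓ c = ⊥ ∧ b ≤ x ∧ c ≤ y := by
  rw [Separates, hnot_closedSub, isConnectedSub_openSub_iff]
  constructor
  · rintro ⟨-, a, b, ⟨h1, h2, -, -⟩, hxa, hyb⟩
    obtain ⟨hxw, hxa⟩ := mem_inf_sub.1 hxa
    obtain ⟨hyw, hyb⟩ := mem_inf_sub.1 hyb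
    rw [closedSub_sup, openSub_le_closedSub_iff] at h1
    rw [inf_assoc, closedSub_inf, sub_eq_bot_iff] at h2
    have h3 : w ≤ a ⊔ b := by
      rw [← openSub_le_openSub_iff, sub_le_openSub_iff]
      exact fun z hz hab => h2 z (mem_inf_sub.2 ⟨hz, hab⟩)
    refine ⟨hxw, hyw, w ⊓ a, w ⊓ b, ?_, ?_, inf_le_right.trans hxa, inf_le_right.trans hyb⟩
    · rw [← inf_sup_left, inf_eq_left.2 h3]
    · rw [← inf_inf_distrib_left, h1]
  · rintro ⟨hxw, hyw, b, c, hbc, hd, hbx, hcy⟩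
    have hxm : x ∈ openSub w ⊓ closedSub b := mem_inf_sub.2 ⟨hxw, hbx⟩
    have hym : y ∈ openSub w ⊓ closedSub c := mem_inf_sub.2 ⟨hyw, hcy⟩
    refine ⟨fun hw => ?_, b, c, ⟨?_, ?_, sub_ne_bot_iff.2 ⟨x, hxm, hx⟩,
      sub_ne_bot_iff.2 ⟨y, hym, hy⟩⟩, hxm, hym⟩
    · rcases hw b c hbc.symm hd with rfl | rfl
      · rw [bot_sup_eq] at hbc
        exact not_le_of_himp_eq hyw hy (hbc ▸ hcy)
      · rw [sup_bot_eq] at hbc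
        exact not_le_of_himp_eq hxw hx (hbc ▸ hbx)
    · rw [closedSub_sup, openSub_le_closedSub_iff, hd, inf_bot_eq]
    · rw [inf_assoc, closedSub_inf, hbc, inf_comm, (isCompl_closedSub_openSub w).inf_eq_bot]

/-- The boundary of `𝔬(d)` separates the elements of an open sublocale disjoint from `𝔬(d)` from
those of `𝔬(d)`. -/
theorem separates_frontier {c d x y : L} (hcd : c ≤ dᶜ) (hx : x ≠ ⊤) (hy : y ≠ ⊤)
    (hxc : c ⇨ x = x) (hyd : d ⇨ y = y) : Separates (closedSub (d ⊔ dᶜ)) x y := by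
  rw [separates_closedSub_iff hx hy]
  refine ⟨openSub_mono_mem (hcd.trans le_sup_right) hxc, openSub_mono_mem le_sup_left hyd,
    d, dᶜ, rfl, inf_compl_self d, le_of_inf_eq_bot hxc ?_, le_of_inf_eq_bot hyd ?_⟩
  · exact disjoint_iff.1 (le_compl_iff_disjoint_left.1 hcd)
  · rw [inf_comm, inf_compl_self]

theorem le_sup_compl_of_sup_eq {d e a : L} (h : d ⊔ e = a) (hd : d ⊓ e = ⊥) : a ≤ d ⊔ dᶜ := by
  rw [← h]
  exact sup_le_sup_left (le_compl_iff_disjoint_left.2 (disjoint_iff.2 hd)) d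

/-- If `c` is a component of a neighbourhood `s` of `𝔠(u)` whose pseudocomplement is a neighbourhood
of `𝔠(v)`, and `d` is a component of `c*`, then the boundary of `𝔬(d)` is non-void, avoids `𝔠(u)` and
`𝔠(v)`, and separates `x ∈ 𝔬(c)` from `y ∈ 𝔬(d)`. -/
theorem frontier_separates (hconn : IsConnectedLocale L) {u v s c c' d d' x y : L}
    (hus : u ⊔ s = ⊤) (hvc : v ⊔ cᶜ = ⊤) (hc : c ⊔ c' = s) (hcd : c ⊓ c' = ⊥)
    (hd : d ⊔ d' = cᶜ) (hdd : d ⊓ d' = ⊥) (hx : x ≠ ⊤) (hy : y ≠ ⊤)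
    (hxc : c ⇨ x = x) (hyd : d ⇨ y = y) :
    d ⊔ dᶜ ≠ ⊤ ∧ closedSub (d ⊔ dᶜ) ≤ ￢(closedSub u ⊔ closedSub v) ∧
      Separates (closedSub (d ⊔ dᶜ)) x y := by
  have hcd' : c ≤ dᶜ := le_compl_comm.1 (hd ▸ le_sup_left)
  have hcw : cᶜ ≤ d ⊔ dᶜ := le_sup_compl_of_sup_eq hd hdd
  have hc'w : c' ≤ d ⊔ dᶜ := (le_compl_iff_disjoint_left.2 (disjoint_iff.2 hcd)).trans hcw
  have hsw : s ≤ d ⊔ dᶜ := hc ▸ sup_le (hcd'.trans le_sup_right) hc'w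
  refine ⟨fun h => ?_, ?_, separates_frontier hcd' hx hy hxc hyd⟩
  · rcases hconn d dᶜ h.symm (inf_compl_self d) with h0 | h0
    · exact ne_bot_of_himp_eq hyd hy h0
    · exact ne_bot_of_himp_eq hxc hx (le_bot_iff.1 (h0 ▸ hcd'))
  · rw [le_hnot_closedSub_sup_iff, sup_inf_left]
    have h1 : d ⊔ dᶜ ⊔ u = ⊤ := by
      rw [sup_comm]
      exact top_le_iff.1 (hus ▸ sup_le_sup_left hsw u)
    have h2 : d ⊔ dᶜ ⊔ v = ⊤ := by
      rw [sup_comm]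
      exact top_le_iff.1 (hvc ▸ sup_le_sup_left hcw v)
    rw [h1, h2, inf_top_eq]

/-- Normality in terms of neighbourhoods of closed sublocales: the open neighbourhood `𝔬(s)` of
`𝔠(u)` has closure `𝔠(s*)` disjoint from `𝔠(v)`. -/
theorem IsNormalLocale.exists_nhd (hn : IsNormalLocale L) {u v : L}
    (h : closedSub u ⊓ closedSub v = ⊥) : ∃ s : L, u ⊔ s = ⊤ ∧ v ⊔ sᶜ = ⊤ := by
  rw [closedSub_inf, closedSub_eq_bot_iff] at h
  obtain ⟨s, t, hst, hu, hv⟩ := hn u v h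
  refine ⟨s, hu, top_le_iff.1 (hv ▸ sup_le_sup_left ?_ v)⟩
  exact le_compl_iff_disjoint_left.2 (disjoint_iff.2 hst)

theorem sup_compl_eq_top_of_le {v s c : L} (hcs : c ≤ s) (h : v ⊔ sᶜ = ⊤) : v ⊔ cᶜ = ⊤ :=
  top_le_iff.1 (h ▸ sup_le_sup_left (compl_le_compl hcs) v)

/-! ### Connectedness of boundaries -/

/-- If `𝔠(k ∨ e)` is a continuum and `k`, `e` are disjoint with `k` connected and nonzero, so that
`𝔬(k)` is a component of the complement of `𝔠(k ∨ e)`, then the boundary `𝔠(k ∨ k*)` of `𝔬(k)` is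
connected.  Non-voidness of the boundary is automatic in a connected locale and is left out. -/
def FrontierConnected (L : Type*) [Order.Frame L] : Prop :=
  ∀ k e : L, IsConnectedSub (closedSub (k ⊔ e)) → k ⊔ e ≠ ⊤ → IsConnectedElement k → k ≠ ⊥ →
    k ⊓ e = ⊥ → IsConnectedSub (closedSub (k ⊔ kᶜ))

theorem BrouwerProperty.frontierConnected (hB : BrouwerProperty L) : FrontierConnected L := by
  intro k e hC hC1 hk hk0 hd
  rw [← boundarySub_openSub]
  refine (hB _ (isContinuum_closedSub_iff.2 ⟨hC1, hC⟩) (openSub k) ?_).2.2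
  rw [hnot_closedSub]
  refine ⟨openSub_le_openSub_iff.2 le_sup_left, openSub_ne_bot hk0,
    isConnectedSub_openSub_iff.2 hk, fun S hS hSc hSk => ?_⟩
  rcases isConnectedSub_iff.1 hSc k e hS (hd ▸ closedSub_bot (L := L) ▸ le_top) with h | h
  · refine absurd (le_bot_iff.1 ?_) hSk
    exact (isCompl_closedSub_openSub k).inf_eq_bot ▸ inf_le_inf_right _ h
  · intro x hx
    have h1 : (k ⊔ e) ⇨ x = x := hS hx
    rwa [sup_himp_distrib, himp_eq_top_iff.2 (h hx), inf_top_eq] at h1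

/-- The complement of a component of the complement of a connected closed sublocale is connected,
since a clopen part of it that misses the closed sublocale would be clopen in `L`. -/
theorem isConnectedSub_closedSub_of_component (hconn : IsConnectedLocale L) {k e : L}
    (hC : IsConnectedSub (closedSub (k ⊔ e))) (hk0 : k ≠ ⊥) (hd : k ⊓ e = ⊥) :
    IsConnectedSub (closedSub k) := by
  have key : ∀ b c : L, b ⊔ c ⊔ k = ⊤ → b ⊓ c ≤ k → b ≤ k ⊔ e → b ≤ k := by
    intro b c h1 h2 hb
    have hbe : b ≤ k ⊔ b ⊓ e := by
      rw [sup_inf_left]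
      exact le_inf le_sup_right hb
    have h3 : (⊤ : L) = (c ⊔ k) ⊔ b ⊓ e := by
      refine le_antisymm (h1 ▸ sup_le (sup_le ?_ ?_) ?_) le_top
      · exact hbe.trans (sup_le_sup_right le_sup_right _)
      · exact le_sup_left.trans le_sup_left
      · exact le_sup_right.trans le_sup_left
    have h4 : (c ⊔ k) ⊓ (b ⊓ e) = ⊥ := by
      refine le_bot_iff.1 (hd ▸ le_inf ?_ (inf_le_right.trans inf_le_right))
      rw [inf_sup_right]
      refine sup_le ?_ inf_le_left
      exact (le_inf (inf_le_right.trans inf_le_left) inf_le_left).trans h2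
    rcases hconn _ _ h3 h4 with h5 | h5
    · exact absurd (le_bot_iff.1 (h5 ▸ le_sup_right)) hk0
    · rwa [h5, sup_bot_eq] at hbe
  rw [isConnectedSub_closedSub_iff] at hC ⊢
  intro b c h1 h2
  have h3 : b ⊔ c ⊔ (k ⊔ e) = ⊤ := by rw [← sup_assoc, h1, top_sup_eq]
  rcases hC b c h3 (h2.trans le_sup_left) with h | h
  · exact Or.inl (key b c h1 h2 h)
  · exact Or.inr (key c b (by rw [sup_comm c, h1]) (by rwa [inf_comm]) h)

theorem IsUnicoherent.frontierConnected (hconn : IsConnectedLocale L) (hU : IsUnicoherent L) :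
    FrontierConnected L := by
  intro k e hC hC1 hk hk0 hd
  have hK : IsContinuum (closedSub k) := by
    refine isContinuum_closedSub_iff.2
      ⟨fun h => hC1 (by rw [h, top_sup_eq]), isConnectedSub_closedSub_of_component hconn hC hk0 hd⟩
  have hH : IsContinuum (closedSub kᶜ) := by
    refine isContinuum_closedSub_iff.2 ⟨fun h => hk0 ?_, hk.isConnectedSub_closedSub_compl⟩
    rwa [← himp_bot, himp_eq_top_iff, le_bot_iff] at h
  have h := hU _ _ hK hH (by rw [closedSub_sup, inf_compl_self, closedSub_bot])
  rw [closedSub_inf] at h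
  exact h.2.2

/-! ### Implications between the conditions -/

theorem PropertyNPlus.propertyN (h : PropertyNPlus L) : PropertyN L := by
  intro u v huv X Y hXu hYv hX hY
  obtain ⟨x, hx, hx1⟩ := sub_ne_bot_iff.1 hX
  obtain ⟨y, hy, hy1⟩ := sub_ne_bot_iff.1 hY
  obtain ⟨W, hW, hWuv, hsep⟩ := h u v huv x (hXu hx) y (hYv hy) hx1 hy1
  exact ⟨W, hW, hWuv, x, hx, hx1, y, hy, hy1, hsep⟩

/-- A connected closed sublocale disjoint from `𝔠(w)` is not separated by `𝔠(w)`. -/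
theorem not_separates_of_connected {k w x y : L} (hk : IsConnectedSub (closedSub k))
    (hkw : w ⊔ k = ⊤) (hx : k ≤ x) (hy : k ≤ y) (hx1 : x ≠ ⊤) (hy1 : y ≠ ⊤) :
    ¬ Separates (closedSub w) x y := by
  rw [separates_closedSub_iff hx1 hy1]
  rintro ⟨hxw, hyw, b, c, hbc, hd, hbx, hcy⟩
  rw [isConnectedSub_closedSub_iff] at hk
  rcases hk b c (hbc ▸ hkw) (hd ▸ bot_le) with h | h
  · exact not_le_of_himp_eq hyw hy1 (hbc ▸ sup_le (h.trans hy) hcy)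
  · exact not_le_of_himp_eq hxw hx1 (hbc ▸ sup_le hbx (h.trans hx))

theorem PropertyN.isUnicoherent (hconn : IsConnectedLocale L) (hN : PropertyN L) :
    IsUnicoherent L := by
  rintro H K ⟨⟨h, rfl⟩, hH0, hH⟩ ⟨⟨k, rfl⟩, hK0, hK⟩ htop
  rw [Ne, closedSub_eq_bot_iff] at hH0 hK0
  have hhk : h ⊓ k = ⊥ := by
    rw [closedSub_sup, ← closedSub_bot] at htop
    exact le_bot_iff.1 (closedSub_le_closedSub_iff.1 htop.le)
  rw [closedSub_inf, isContinuum_closedSub_iff, isConnectedSub_closedSub_iff]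
  refine ⟨fun h1 => ?_, fun b c hbc hle => ?_⟩
  · rcases hconn h k h1.symm hhk with rfl | rfl
    · exact hK0 (by rwa [bot_sup_eq] at h1)
    · exact hH0 (by rwa [sup_bot_eq] at h1)
  by_contra hcon
  push Not at hcon
  set a := h ⊔ k with ha
  -- `𝔠(a ⊔ b)` and `𝔠(a ⊔ c)` are complementary closed parts of `𝔠(a)`, both non-void.
  have hb1 : a ⊔ b ≠ ⊤ := fun h1 => hcon.2 <| by
    calc c = c ⊓ (a ⊔ b) := by rw [h1, inf_top_eq]
      _ ≤ a := by
        rw [inf_sup_left, inf_comm c b]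
        exact sup_le inf_le_right hle
  have hc1 : a ⊔ c ≠ ⊤ := fun h1 => hcon.1 <| by
    calc b = b ⊓ (a ⊔ c) := by rw [h1, inf_top_eq]
      _ ≤ a := by
        rw [inf_sup_left]
        exact sup_le inf_le_right hle
  have hdisj : closedSub (a ⊔ b) ⊓ closedSub (a ⊔ c) = ⊥ := by
    rw [closedSub_inf, closedSub_eq_bot_iff, ← sup_sup_distrib_left, sup_comm a, hbc]
  obtain ⟨W, ⟨⟨w, rfl⟩, -, hW⟩, hWle, x, hx, hx1, y, hy, hy1, hsep⟩ :=
    hN _ _ hdisj _ _ le_rfl le_rfl (mt closedSub_eq_bot_iff.1 hb1) (mt closedSub_eq_bot_iff.1 hc1)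
  rw [le_hnot_closedSub_sup_iff, ← sup_inf_left, sup_eq_left.2 hle] at hWle
  have hax : a ≤ x := le_sup_left.trans (mem_closedSub.1 hx)
  have hay : a ≤ y := le_sup_left.trans (mem_closedSub.1 hy)
  -- The continuum `𝔠(w)` avoids `𝔠(h) ∩ 𝔠(k)`, hence misses `𝔠(k)` or `𝔠(h)`.
  rw [isConnectedSub_closedSub_iff] at hW
  rcases hW h k (by rw [sup_comm, hWle]) (hhk ▸ bot_le) with h1 | h1
  · refine not_separates_of_connected hK ?_ (le_sup_right.trans hax) (le_sup_right.trans hay)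
      hx1 hy1 hsep
    rwa [ha, ← sup_assoc, sup_eq_left.2 h1] at hWle
  · refine not_separates_of_connected hH ?_ (le_sup_left.trans hax) (le_sup_left.trans hay)
      hx1 hy1 hsep
    rwa [ha, sup_comm h, ← sup_assoc, sup_eq_left.2 h1] at hWle

theorem FrontierConnected.isContinuum {c d d' : L} (hF : FrontierConnected L)
    (hc : IsConnectedElement c) (hc0 : c ≠ ⊥) (hd : IsConnectedElement d) (hd0 : d ≠ ⊥)
    (hdc : d ⊔ d' = cᶜ) (hdd : d ⊓ d' = ⊥) (hw : d ⊔ dᶜ ≠ ⊤) :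
    IsContinuum (closedSub (d ⊔ dᶜ)) := by
  refine isContinuum_closedSub_iff.2 ⟨hw, hF d d' ?_ ?_ hd hd0 hdd⟩
  · rw [hdc]
    exact hc.isConnectedSub_closedSub_compl
  · rwa [hdc, Ne, ← himp_bot, himp_eq_top_iff, le_bot_iff]

theorem FrontierConnected.propertyN (hF : FrontierConnected L) (hconn : IsConnectedLocale L)
    (hloc : IsLocallyConnected L) (hn : IsNormalLocale L) : PropertyN L := by
  intro u v huv X Y hXu hYv hX hY
  obtain ⟨s, hus, hvs⟩ := hn.exists_nhd huv
  obtain ⟨c, c', hc, hcs, hcc, x, hx, hx1, hxc⟩ := exists_component_meeting hloc hX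
    (hXu.trans (closedSub_le_openSub_iff.2 hus))
  have hvc := sup_compl_eq_top_of_le (hcs ▸ le_sup_left : c ≤ s) hvs
  obtain ⟨d, d', hd, hdc, hdd, y, hy, hy1, hyd⟩ := exists_component_meeting hloc hY
    (hYv.trans (closedSub_le_openSub_iff.2 hvc))
  obtain ⟨hw, hle, hsep⟩ := frontier_separates hconn hus hvc hcs hcc hdc hdd hx1 hy1 hxc hyd
  exact ⟨_, hF.isContinuum hc (ne_bot_of_himp_eq hxc hx1) hd (ne_bot_of_himp_eq hyd hy1)
    hdc hdd hw, hle, x, hx, hx1, y, hy, hy1, hsep⟩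

/-- In a connected, normal and strongly locally connected locale, the elements `x` and `y` of
disjoint closed sublocales are contained in connected `𝔬(c)` and `𝔬(d)`, with `d` a component of
`c*`, such that the boundary of `𝔬(d)` avoids these closed sublocales and separates `x` from `y`. -/
theorem exists_frontier_separates (hconn : IsConnectedLocale L) (hloc : IsLocallyConnected L)
    (hn : IsNormalLocale L) (hslc : IsStronglyLocallyConnected L) {u v x y : L}
    (huv : closedSub u ⊓ closedSub v = ⊥) (hx : x ∈ closedSub u) (hy : y ∈ closedSub v)
    (hx1 : x ≠ ⊤) (hy1 : y ≠ ⊤) :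
    ∃ c d d' : L, IsConnectedElement c ∧ IsConnectedElement d ∧ d ⊔ d' = cᶜ ∧ d ⊓ d' = ⊥ ∧
      c ⇨ x = x ∧ d ⇨ y = y ∧ d ⊔ dᶜ ≠ ⊤ ∧
      closedSub (d ⊔ dᶜ) ≤ ￢(closedSub u ⊔ closedSub v) ∧
      Separates (closedSub (d ⊔ dᶜ)) x y := by
  obtain ⟨s, hus, hvs⟩ := hn.exists_nhd huv
  obtain ⟨c, c', hc, hcs, hcc, hxc⟩ :=
    hslc.exists_component_mem hloc (closedSub_le_openSub_iff.2 hus hx) hx1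
  have hvc := sup_compl_eq_top_of_le (hcs ▸ le_sup_left : c ≤ s) hvs
  obtain ⟨d, d', hd, hdc, hdd, hyd⟩ :=
    hslc.exists_component_mem hloc (closedSub_le_openSub_iff.2 hvc hy) hy1
  exact ⟨c, d, d', hc, hd, hdc, hdd, hxc, hyd,
    frontier_separates hconn hus hvc hcs hcc hdc hdd hx1 hy1 hxc hyd⟩

theorem FrontierConnected.propertyNPlus (hF : FrontierConnected L) (hconn : IsConnectedLocale L)
    (hloc : IsLocallyConnected L) (hn : IsNormalLocale L) (hslc : IsStronglyLocallyConnected L) :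
    PropertyNPlus L := by
  intro u v huv x hx y hy hx1 hy1
  obtain ⟨c, d, d', hc, hd, hdc, hdd, hxc, hyd, hw, hle, hsep⟩ :=
    exists_frontier_separates hconn hloc hn hslc huv hx hy hx1 hy1
  exact ⟨_, hF.isContinuum hc (ne_bot_of_himp_eq hxc hx1) hd (ne_bot_of_himp_eq hyd hy1)
    hdc hdd hw, hle, hsep⟩

/-- If `𝔠(w)` separates `x` from `y`, then so does every closed sublocale containing `𝔠(w)` to whose
complement `x` and `y` belong. -/
theorem Separates.of_le {w u x y : L} (hx1 : x ≠ ⊤) (hy1 : y ≠ ⊤) (huw : u ≤ w)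
    (hx : u ⇨ x = x) (hy : u ⇨ y = y) (h : Separates (closedSub w) x y) :
    Separates (closedSub u) x y := by
  rw [separates_closedSub_iff hx1 hy1] at h ⊢
  obtain ⟨-, -, b, c, hbc, hd, hbx, hcy⟩ := h
  refine ⟨hx, hy, u ⊓ b, u ⊓ c, ?_, ?_, inf_le_right.trans hbx, inf_le_right.trans hcy⟩
  · rw [← inf_sup_left, hbc, inf_eq_left.2 huw]
  · rw [← inf_inf_distrib_left, hd, inf_bot_eq]

theorem FrontierConnected.propertyIPlus (hF : FrontierConnected L)
    (hloc : IsLocallyConnected L) (hslc : IsStronglyLocallyConnected L) : PropertyIPlus L := by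
  intro x y hx1 hy1 u v huv hnu hnv hsep
  rw [closedSub_inf, closedSub_eq_bot_iff] at huv
  rw [closedSub_sup, separates_closedSub_iff hx1 hy1] at hsep
  obtain ⟨hx, hy, b, b', hbb, hbd, hbx, hby⟩ := hsep
  obtain ⟨p, p', hp, hpe, hpd, hxp⟩ := hslc.exists_component_mem hloc hx hx1
  -- `x` lies in the part `𝔬(b')` of the separation, so `𝔬(b')` contains the component of `x`.
  have hpb : p ≤ b' := (hp.le_or (hbb ▸ hpe ▸ le_sup_left) hbd).resolve_left fun h =>
    not_le_of_himp_eq hxp hx1 (h.trans hbx)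
  have hyb : b ⇨ y = y := by
    rwa [← hbb, sup_himp_distrib, himp_eq_top_iff.2 hby, inf_top_eq] at hy
  have hbp : b ≤ pᶜ := by
    rw [le_compl_iff_disjoint_right, disjoint_iff]
    exact le_bot_iff.1 (hbd ▸ inf_le_inf_left b hpb)
  obtain ⟨r, r', hr, hre, hrd, hyr⟩ :=
    hslc.exists_component_mem hloc (openSub_mono_mem hbp hyb) hy1
  have hpr : p ≤ rᶜ := le_compl_comm.1 (hre ▸ le_sup_left)
  have hp0 := ne_bot_of_himp_eq hxp hx1
  have hW : IsConnectedSub (closedSub (r ⊔ rᶜ)) := by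
    refine hF r r' ?_ ?_ hr (ne_bot_of_himp_eq hyr hy1) hrd
    · rw [hre]
      exact hp.isConnectedSub_closedSub_compl
    · rwa [hre, Ne, ← himp_bot, himp_eq_top_iff, le_bot_iff]
  have hle : u ⊓ v ≤ r ⊔ rᶜ := by
    rw [← hpe]
    refine sup_le (hpr.trans le_sup_right) ?_
    exact (le_compl_iff_disjoint_left.2 (disjoint_iff.2 hpd)).trans (le_sup_compl_of_sup_eq hre hrd)
  have hsepW := separates_frontier hpr hx1 hy1 hxp hyr
  rcases isConnectedSub_closedSub_iff.1 hW u v (by rw [huv, top_sup_eq]) hle with h | h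
  · exact hnu (hsepW.of_le hx1 hy1 h (openSub_mono_mem inf_le_left hx)
      (openSub_mono_mem inf_le_left hy))
  · exact hnv (hsepW.of_le hx1 hy1 h (openSub_mono_mem inf_le_right hx)
      (openSub_mono_mem inf_le_right hy))

/-- If `𝔠(w)` lies in the closures of two connected open sublocales `𝔬(d) ∋ y` and `𝔬(e) ∋ x`, both
contained in `𝔬(w)`, then no closed part `𝔠(f)` of `𝔠(w)` separates `x` from `y`, unless the
complementary part `𝔠(g)` is void. -/
theorem eq_top_of_separates {d e f g w x y : L} (hd : IsConnectedElement d)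
    (he : IsConnectedElement e) (hdw : d ≤ w) (hew : e ≤ w) (hdc : dᶜ ≤ w) (hec : eᶜ ≤ w)
    (hfg : f ⊔ g = ⊤) (hwf : w ≤ f) (hwg : w ≤ g) (hx1 : x ≠ ⊤) (hy1 : y ≠ ⊤)
    (hxe : e ⇨ x = x) (hyd : d ⇨ y = y) (hsep : Separates (closedSub f) x y) : g = ⊤ := by
  rw [separates_closedSub_iff hx1 hy1] at hsep
  obtain ⟨-, -, b, c, hbc, hbd, hbx, hcy⟩ := hsep
  have hec' : e ≤ c := (he.le_or (hbc ▸ hew.trans hwf) hbd).resolve_left fun h =>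
    not_le_of_himp_eq hxe hx1 (h.trans hbx)
  have hdb : d ≤ b := (hd.le_or (hbc ▸ hdw.trans hwf) hbd).resolve_right fun h =>
    not_le_of_himp_eq hyd hy1 (h.trans hcy)
  have hb : b ≤ eᶜ := by
    rw [le_compl_iff_disjoint_right, disjoint_iff]
    exact le_bot_iff.1 (hbd ▸ inf_le_inf_left b hec')
  have hc : c ≤ dᶜ := by
    rw [le_compl_iff_disjoint_left, disjoint_iff]
    exact le_bot_iff.1 (hbd ▸ inf_le_inf_right c hdb)
  have hfg' : f ≤ g := hbc ▸ sup_le ((hb.trans hec).trans hwg) ((hc.trans hdc).trans hwg)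
  rwa [sup_eq_right.2 hfg'] at hfg

theorem PropertyIPlus.propertyNPlus (hI : PropertyIPlus L) (hconn : IsConnectedLocale L)
    (hloc : IsLocallyConnected L) (hn : IsNormalLocale L) (hslc : IsStronglyLocallyConnected L) :
    PropertyNPlus L := by
  intro u v huv x hx y hy hx1 hy1
  obtain ⟨c, d, d', hc, hd, hdc, hdd, hxc, hyd, hw, hle, hsep⟩ :=
    exists_frontier_separates hconn hloc hn hslc huv hx hy hx1 hy1
  refine ⟨_, isContinuum_closedSub_iff.2 ⟨hw, ?_⟩, hle, hsep⟩
  have hcd : c ≤ dᶜ := le_compl_comm.1 (hdc ▸ le_sup_left)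
  obtain ⟨e, e', he, hce, hee, -⟩ := exists_component hloc hc (ne_bot_of_himp_eq hxc hx1) hcd
  have hxe : e ⇨ x = x := openSub_mono_mem hce hxc
  set w := d ⊔ dᶜ with hwdef
  have hew : e ≤ w := (hee ▸ le_sup_left : e ≤ dᶜ).trans le_sup_right
  have hec : eᶜ ≤ w := (compl_le_compl hce).trans (le_sup_compl_of_sup_eq hdc hdd)
  rw [isConnectedSub_closedSub_iff]
  intro f g hfg hfgw
  by_contra hcon
  push Not at hcon
  have htop : (w ⊔ f) ⊔ (w ⊔ g) = ⊤ := by rw [← sup_sup_distrib_left, sup_comm, hfg]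
  have hinf : (w ⊔ f) ⊓ (w ⊔ g) = w := by rw [← sup_inf_left, sup_eq_left.2 hfgw]
  have hf : w ⊔ f ≠ ⊤ := fun h => hcon.2 <| by
    rw [h, top_inf_eq] at hinf
    exact hinf ▸ le_sup_right
  have hg : w ⊔ g ≠ ⊤ := fun h => hcon.1 <| by
    rw [h, inf_top_eq] at hinf
    exact hinf ▸ le_sup_right
  refine hI x y hx1 hy1 (w ⊔ f) (w ⊔ g) (by rw [closedSub_inf, closedSub_eq_bot_iff, htop])
    (fun h => hg ?_) (fun h => hf ?_) (by rwa [closedSub_sup, hinf])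
  · exact eq_top_of_separates hd he le_sup_left hew le_sup_right hec htop le_sup_left le_sup_left
      hx1 hy1 hxe hyd h
  · exact eq_top_of_separates hd he le_sup_left hew le_sup_right hec (by rwa [sup_comm])
      le_sup_left le_sup_left hx1 hy1 hxe hyd h

end PointFree

theorem theorem5p4 {L : Type*} [Order.Frame L]
    (hconn : PointFree.IsConnectedLocale L) (hloc : PointFree.IsLocallyConnected L) :
    (PointFree.PropertyNPlus L → PointFree.PropertyN L) ∧
    (PointFree.PropertyN L → PointFree.IsUnicoherent L) ∧
    (PointFree.IsNormalLocale L →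
      (PointFree.BrouwerProperty L → PointFree.PropertyN L) ∧
      (PointFree.PropertyN L ↔ PointFree.IsUnicoherent L)) ∧
    (PointFree.IsNormalLocale L → PointFree.IsStronglyLocallyConnected L →
      (PointFree.BrouwerProperty L → PointFree.PropertyNPlus L) ∧
      (PointFree.PropertyNPlus L ↔ PointFree.PropertyN L) ∧
      (PointFree.PropertyNPlus L ↔ PointFree.IsUnicoherent L) ∧
      (PointFree.PropertyNPlus L ↔ PointFree.PropertyIPlus L)) := by
  have hNU : PointFree.PropertyN L → PointFree.IsUnicoherent L := fun h => h.isUnicoherent hconn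
  have hUF : PointFree.IsUnicoherent L → PointFree.FrontierConnected L :=
    fun h => h.frontierConnected hconn
  refine ⟨fun h => h.propertyN, hNU, fun hn => ⟨fun h => ?_, hNU, fun h => ?_⟩,
    fun hn hs => ⟨fun h => ?_, ⟨fun h => h.propertyN, fun h => ?_⟩,
      ⟨fun h => hNU h.propertyN, fun h => ?_⟩, fun h => ?_, fun h => ?_⟩⟩
  · exact h.frontierConnected.propertyN hconn hloc hn
  · exact (hUF h).propertyN hconn hloc hn
  · exact h.frontierConnected.propertyNPlus hconn hloc hn hs
  · exact (hUF (hNU h)).propertyNPlus hconn hloc hn hs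
  · exact (hUF h).propertyNPlus hconn hloc hn hs
  · exact (hUF (hNU h.propertyN)).propertyIPlus hloc hs
  · exact h.propertyNPlus hconn hloc hn hs
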